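/- A \emph{left-approximation} of a real number $x$ is a computable, strictly increasing sequence $(x_n)_{n\in\mathbb N}$ of rational numbers converging to $x$; its \emph{speed quotients} are $\rho(n)=\frac{x_{n+1}-x_n}{x-x_n}\in(0,1)$. A real number is \emph{left-computable} if it has a left-approximation, \emph{speedable} if it has a left-approximation with $\limsup_{n\to\infty}\rho(n)>0$, and \emph{superspeedable} if it has a left-approximation with $\limsup_{n\to\infty}\rho(n)=1$. An infinite set $A\subseteq\mathbb N$ is \emph{immune} if it has no infinite computably enumerable subset, and a real number $x\in[0,1]$ is \emph{immune} if $x=\sum_{n\in A}2^{-(n+1)}$ for some immune set $A\subseteq\mathbb N$. \textbf{Theorem.} There is a left-computable number $x\in[0,1]$ that is neither immune nor superspeedable and that is speedable. In particular, there is a speedable number that is not superspeedable. -/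

import Mathlib

open Filter Topology

/-- A sequence of rational numbers is computable if `a n = (p n - q n) / (r n + 1)` for
computable functions `p, q, r : ℕ → ℕ`. -/
def ComputableRatSeq (a : ℕ → ℚ) : Prop :=
  ∃ p q r : ℕ → ℕ, Computable p ∧ Computable q ∧ Computable r ∧
    ∀ n, a n = ((p n : ℚ) - (q n : ℚ)) / ((r n : ℚ) + 1)

/-- `a` is a left-approximation of `x`: a computable, (strictly) increasing sequence of rational
numbers converging to `x`. -/
structure IsLeftApproximation (a : ℕ → ℚ) (x : ℝ) : Prop where
  computable : ComputableRatSeq a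
  strictMono : StrictMono a
  tendsto : Tendsto (fun n => (a n : ℝ)) atTop (𝓝 x)

/-- The real number `x` is left-computable if it has a left-approximation. -/
def LeftComputable (x : ℝ) : Prop :=
  ∃ a : ℕ → ℚ, IsLeftApproximation a x

/-- The `n`-th speed quotient of a sequence `a` converging to `x` from below. -/
noncomputable def speedQuotient (a : ℕ → ℚ) (x : ℝ) (n : ℕ) : ℝ :=
  ((a (n + 1) : ℝ) - (a n : ℝ)) / (x - (a n : ℝ))

theorem IsLeftApproximation.lt {a : ℕ → ℚ} {x : ℝ} (h : IsLeftApproximation a x) (n : ℕ) :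
    (a n : ℝ) < x := by
  have hm : StrictMono (fun n => (a n : ℝ)) := fun i j hij =>
    Rat.cast_lt.mpr (h.strictMono hij)
  exact lt_of_lt_of_le (hm (Nat.lt_succ_self n)) (hm.monotone.ge_of_tendsto h.tendsto (n + 1))

/-- The speed quotients of a left-approximation lie in `(0, 1)`, so their limit superior in `ℝ`
is the genuine one. -/
theorem IsLeftApproximation.speedQuotient_mem {a : ℕ → ℚ} {x : ℝ}
    (h : IsLeftApproximation a x) (n : ℕ) : speedQuotient a x n ∈ Set.Ioo (0 : ℝ) 1 := by
  have h0 := h.lt n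
  have h1 := h.lt (n + 1)
  have h2 : (a n : ℝ) < (a (n + 1) : ℝ) := by
    exact_mod_cast h.strictMono (Nat.lt_succ_self n)
  unfold speedQuotient
  refine ⟨div_pos (by linarith) (by linarith), ?_⟩
  rw [div_lt_one (by linarith)]
  linarith

/-- `x` is speedable if it has a left-approximation whose speed quotients have a positive
limit superior. -/
def Speedable (x : ℝ) : Prop :=
  ∃ a : ℕ → ℚ, IsLeftApproximation a x ∧ 0 < limsup (speedQuotient a x) atTop

/-- `x` is superspeedable if it has a left-approximation whose speed quotients have limit
superior equal to `1`. -/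
def Superspeedable (x : ℝ) : Prop :=
  ∃ a : ℕ → ℚ, IsLeftApproximation a x ∧ limsup (speedQuotient a x) atTop = 1

/-- A set of natural numbers is immune if it is infinite and has no infinite computably
enumerable subset. -/
def ImmuneSet (A : Set ℕ) : Prop :=
  A.Infinite ∧ ∀ B : Set ℕ, B ⊆ A → B.Infinite → ¬ REPred (fun n => n ∈ B)

/-- The real number `x_A = ∑_{n ∈ A} 2^{-(n+1)}` in `[0, 1]`. -/
noncomputable def realOfSet (A : Set ℕ) : ℝ :=
  ∑' n : ℕ, A.indicator (fun n => ((1 : ℝ) / 2) ^ (n + 1)) n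

/-- A real number (in `[0, 1]`) is immune if it equals `x_A` for an immune set `A`. -/
def ImmuneReal (x : ℝ) : Prop :=
  ∃ A : Set ℕ, ImmuneSet A ∧ realOfSet A = x

/-! The number is the limit of the left end points of dyadic cells, the leftmost `Allowed` cell at
each level `s`. Two kinds of conditions define `Allowed`.

Against superspeedability: if the `e`-th computable sequence makes a step from `a n` to `a (n + 1)`,
the interval of length `lag e ^ 2 * (a (n + 1) - a n)` just to the right of `a (n + 1)` is
forbidden. A limit beyond it has speed quotient at most `1 / (1 + lag e ^ 2)` there. Cells survive
because the steps of one sequence are disjoint, so that they forbid only a small proportion of the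
candidates, summable over `e` (`exists_goodCell_child`).

On the digits: the truncation of `x` at each `level k` is 1 mod 4. The final digit 1 yields a
decidable infinite set of ones, so `x` is not immune. The digit 0 before it makes truncations jump
by at least 4 units, which leaves room for a term one unit below the new value. When that value is
final, the next term covers at least one of fewer than two remaining units
(`half_le_speedQuotient`). -/

/-! ### Counting estimates -/

/-- Ordered pairwise disjoint steps `[b n, b (n + 1)]` inside `[lo, hi]` have total length at most
`hi - lo`. -/
theorem sum_steps_le (b : ℕ → ℝ) (lo : ℝ) (G : Finset ℕ) :
    ∀ hi : ℝ, lo ≤ hi → (∀ n ∈ G, lo ≤ b n) → (∀ n ∈ G, b (n + 1) ≤ hi) →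
      (∀ n ∈ G, ∀ n' ∈ G, n < n' → b (n + 1) ≤ b n') →
      ∑ n ∈ G, (b (n + 1) - b n) ≤ hi - lo := by
  induction G using Finset.induction_on_max with
  | empty => intro hi h; simp [h]
  | insert a s ha ih =>
    intro hi _ hlo hhi hord
    have hnot : a ∉ s := fun h => lt_irrefl _ (ha a h)
    rw [Finset.sum_insert hnot]
    have := ih (b a) (hlo a (by simp)) (fun n hn => hlo n (by simp [hn]))
      (fun n hn => hord n (by simp [hn]) a (by simp) (ha n hn))
      (fun n hn n' hn' => hord n (by simp [hn]) n' (by simp [hn']))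
    have := hhi a (by simp)
    linarith

/-- Bounds the children of the cell `[L, L + N]` lost to one sequence. Since `η * step ≥ 1`, each
loss is at most `3 * η * step`. All steps but the first start after the first one ends, hence lie in
`[L - N, L + N]` and contribute at most `6 * η * N`; the first may start far to the left and is
charged `η * N + 2`. -/
theorem sum_penalty_le (b : ℕ → ℝ) (G : Finset ℕ) {η N L : ℝ} (hη : 0 < η) (hη1 : η ≤ 1)
    (hN : 0 ≤ N)
    (hord : ∀ n ∈ G, ∀ n' ∈ G, n < n' → b (n + 1) ≤ b n')
    (hbig : ∀ n ∈ G, 1 ≤ η * (b (n + 1) - b n))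
    (hsmall : ∀ n ∈ G, η * (b (n + 1) - b n) ≤ N)
    (hright : ∀ n ∈ G, b (n + 1) ≤ L + N)
    (hleft : ∀ n ∈ G, L ≤ b (n + 1) + η ^ 2 * (b (n + 1) - b n)) :
    ∑ n ∈ G, (η ^ 2 * (b (n + 1) - b n) + 2) ≤ 7 * η * N + 2 := by
  rcases G.eq_empty_or_nonempty with rfl | hG
  · simp; positivity
  set n₀ := G.min' hG
  have hn₀ : n₀ ∈ G := G.min'_mem hG
  rw [← Finset.add_sum_erase G _ hn₀]
  have h1 : η ^ 2 * (b (n₀ + 1) - b n₀) ≤ η * N := by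
    have := mul_le_mul_of_nonneg_left (hsmall n₀ hn₀) hη.le
    nlinarith
  have h2 : ∑ n ∈ G.erase n₀, (b (n + 1) - b n) ≤ (L + N) - (L - N) := by
    apply sum_steps_le b _ _ _ (by linarith)
    · intro n hn
      have hn' := Finset.mem_of_mem_erase hn
      have hlt : n₀ < n := lt_of_le_of_ne (G.min'_le n hn') (Finset.ne_of_mem_erase hn).symm
      have := hord n₀ hn₀ n hn' hlt
      have := hleft n₀ hn₀
      nlinarith
    · exact fun n hn => hright n (Finset.mem_of_mem_erase hn)
    · exact fun n hn n' hn' => hord n (Finset.mem_of_mem_erase hn) n' (Finset.mem_of_mem_erase hn')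
  have h3 : ∑ n ∈ G.erase n₀, (η ^ 2 * (b (n + 1) - b n) + 2)
      ≤ ∑ n ∈ G.erase n₀, 3 * η * (b (n + 1) - b n) := by
    apply Finset.sum_le_sum
    intro n hn
    have := hbig n (Finset.mem_of_mem_erase hn)
    nlinarith
  rw [← Finset.mul_sum] at h3
  have h4 : 3 * η * ∑ n ∈ G.erase n₀, (b (n + 1) - b n) ≤ 3 * η * (2 * N) :=
    mul_le_mul_of_nonneg_left (by linarith) (by positivity)
  linarith

theorem card_filter_between_le (S : Finset ℕ) {x y : ℝ} (hxy : x ≤ y) :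
    ((S.filter fun j : ℕ => (j : ℝ) < y ∧ x < j + 1).card : ℝ) ≤ y - x + 2 := by
  set T := S.filter fun j : ℕ => (j : ℝ) < y ∧ x < j + 1
  rcases T.eq_empty_or_nonempty with hT | hT
  · rw [hT]; simp; linarith
  have hmax := (Finset.mem_filter.1 (T.max'_mem hT)).2.1
  have hmin := (Finset.mem_filter.1 (T.min'_mem hT)).2.2
  have hsub : T ⊆ Finset.Icc (T.min' hT) (T.max' hT) := fun j hj =>
    Finset.mem_Icc.2 ⟨T.min'_le j hj, T.le_max' j hj⟩
  have hcard := Finset.card_le_card hsub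
  rw [Nat.card_Icc] at hcard
  have hle : T.min' hT ≤ T.max' hT := T.min'_le _ (T.max'_mem hT)
  have : T.card + T.min' hT ≤ T.max' hT + 1 := by omega
  have : (T.card : ℝ) + (T.min' hT : ℕ) ≤ (T.max' hT : ℕ) + 1 := by exact_mod_cast this
  linarith

/-! ### Existence of good dyadic cells -/

/-- Level `k` cells have length `2 ^ (-level k)`. -/
def level (k : ℕ) : ℕ := (k + 3) ^ 2

theorem level_succ (k : ℕ) : level (k + 1) = level k + (2 * k + 7) := by
  unfold level; ring

theorem level_strictMono : StrictMono level :=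
  strictMono_nat_of_lt_succ fun k => by rw [level_succ]; omega

/-- The linear loss `7 * lag e` must sum over `e` to less than the proportion `1 / 4` of children
that are 1 mod 4. -/
noncomputable def lag (e : ℕ) : ℝ := (1 / 2) ^ (e + 6)

theorem lag_pos (e : ℕ) : 0 < lag e := by unfold lag; positivity

theorem lag_lt_one (e : ℕ) : lag e < 1 := pow_lt_one₀ (by norm_num) (by norm_num) (by omega)

theorem sum_lag_le (k : ℕ) : ∑ e ∈ Finset.range k, lag e ≤ 1 / 32 := by
  have : ∀ k, ∑ e ∈ Finset.range k, lag e = 1 / 32 - (1 / 2) ^ (k + 5) := by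
    intro k
    induction k with
    | zero => norm_num
    | succ k ih => rw [Finset.sum_range_succ, ih, lag]; ring
  rw [this]
  have : (0 : ℝ) ≤ (1 / 2) ^ (k + 5) := by positivity
  linarith

/-- The cell `[m, m + 1] * 2 ^ (-level k)` meets a step interval of the `e`-th sequence only
if that interval is short compared to the cell. -/
def GoodCell (a : ℕ → ℕ → ℝ) (F : ℕ → Finset ℕ) (k m : ℕ) : Prop :=
  ∀ e, ∀ n ∈ F e, a e (n + 1) * 2 ^ level k < m + 1 →
    (m : ℝ) < (a e (n + 1) + lag e ^ 2 * (a e (n + 1) - a e n)) * 2 ^ level k →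
    lag e * (a e (n + 1) - a e n) * 2 ^ level k < 1

/-- A count: among the `N / 4` children that are 1 mod 4, those spoiled by some step are fewer.
Goodness of the parent bounds the relevant steps, as `sum_penalty_le` requires. -/
theorem exists_goodCell_child {a : ℕ → ℕ → ℝ} {F : ℕ → Finset ℕ}
    (hord : ∀ e, ∀ n ∈ F e, ∀ n' ∈ F e, n < n' → a e (n + 1) ≤ a e n')
    (hpos : ∀ e, ∀ n ∈ F e, a e n < a e (n + 1))
    (hsmall : ∀ e, ∀ n ∈ F e, (a e (n + 1) - a e n) * 2 ^ level e ≤ 1)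
    {k m : ℕ} (hm : GoodCell a F k m) :
    ∃ j, j % 4 = 1 ∧ j / 2 ^ (2 * k + 7) = m ∧ GoodCell a F (k + 1) j := by
  classical
  set N : ℕ := 2 ^ (2 * k + 7) with hN
  set b : ℕ → ℕ → ℝ := fun e n => a e n * 2 ^ level (k + 1) with hb
  have hNpos : 0 < N := by positivity
  have hlev : (2 : ℝ) ^ level (k + 1) = 2 ^ level k * N := by
    rw [level_succ, pow_add, hN]; push_cast; rfl
  have hbj : ∀ e n, b e (n + 1) - b e n = (a e (n + 1) - a e n) * 2 ^ level (k + 1) := by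
    intro e n; simp only [hb]; ring
  let G : ℕ → Finset ℕ := fun e => (F e).filter fun n =>
    1 ≤ lag e * (b e (n + 1) - b e n) ∧ b e (n + 1) < (m + 1) * N ∧
      (m : ℝ) * N < b e (n + 1) + lag e ^ 2 * (b e (n + 1) - b e n)
  let C : Finset ℕ := (Finset.range (N / 4)).image fun i => m * N + (4 * i + 1)
  let K : Finset ℕ := (Finset.range (k + 1)).biUnion fun e => (G e).biUnion fun n =>
    C.filter fun j : ℕ => (j : ℝ) < b e (n + 1) + lag e ^ 2 * (b e (n + 1) - b e n) ∧
      b e (n + 1) < j + 1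
  have hCcard : C.card = N / 4 := by
    rw [Finset.card_image_of_injective _ (fun i i' h => by simpa using h), Finset.card_range]
  have hNdvd : 4 * (N / 4) = N := by
    rw [hN, show 2 * k + 7 = 2 * k + 5 + 2 by ring, pow_add]; omega
  have hpen : ∀ e, ∑ n ∈ G e, (lag e ^ 2 * (b e (n + 1) - b e n) + 2) ≤ 7 * lag e * N + 2 := by
    intro e
    apply sum_penalty_le (L := m * N) _ _ (lag_pos e) (lag_lt_one e).le (by positivity)
    · intro n hn n' hn' h
      exact mul_le_mul_of_nonneg_right (hord e n (Finset.mem_filter.1 hn).1 n'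
        (Finset.mem_filter.1 hn').1 h) (by positivity)
    · exact fun n hn => (Finset.mem_filter.1 hn).2.1
    · intro n hn
      obtain ⟨hnF, -, h2, h3⟩ := Finset.mem_filter.1 hn
      have hNr : (0 : ℝ) < N := by exact_mod_cast hNpos
      have := hm e n hnF (by
        simp only [hb, hlev] at h2
        rw [← mul_assoc] at h2
        exact lt_of_mul_lt_mul_right h2 hNr.le) (by
        rw [hbj, hlev] at h3
        simp only [hb, hlev] at h3
        apply lt_of_mul_lt_mul_right _ hNr.le
        linarith)
      rw [hbj, hlev]
      nlinarith
    · intro n hn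
      have := (Finset.mem_filter.1 hn).2.2.1
      linarith
    · exact fun n hn => (Finset.mem_filter.1 hn).2.2.2.le
  have hKcard : K.card < C.card := by
    have h1 : (K.card : ℝ) ≤ ∑ e ∈ Finset.range (k + 1), (7 * lag e * N + 2) := by
      have hK : K.card ≤ ∑ e ∈ Finset.range (k + 1), ∑ n ∈ G e, _ :=
        Finset.card_biUnion_le.trans (Finset.sum_le_sum fun e _ => Finset.card_biUnion_le)
      have hK' := Nat.cast_le (α := ℝ).2 hK
      simp only [Nat.cast_sum] at hK'
      refine hK'.trans ?_
      apply Finset.sum_le_sum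
      intro e _
      refine le_trans (Finset.sum_le_sum fun n hn => ?_) (hpen e)
      have h0 : 0 ≤ lag e ^ 2 * (b e (n + 1) - b e n) := by
        have := hpos e n (Finset.mem_filter.1 hn).1
        rw [hbj]
        have : 0 < a e (n + 1) - a e n := by linarith
        positivity
      refine (card_filter_between_le C (by linarith)).trans ?_
      linarith
    have h2 : ∑ e ∈ Finset.range (k + 1), (7 * lag e * N + 2)
        = 7 * N * ∑ e ∈ Finset.range (k + 1), lag e + 2 * (k + 1) := by
      rw [Finset.sum_add_distrib, Finset.mul_sum]
      simp only [Finset.sum_const, Finset.card_range, nsmul_eq_mul]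
      push_cast
      rw [mul_comm ((k : ℝ) + 1) 2]
      congr 1
      exact Finset.sum_congr rfl fun e _ => by ring
    have h3 : 7 * (N : ℝ) * ∑ e ∈ Finset.range (k + 1), lag e ≤ 7 * N * (1 / 32) :=
      mul_le_mul_of_nonneg_left (sum_lag_le _) (by positivity)
    -- The loss is at most `7 * N / 32 + 2 * (k + 1)`, so it stays below `N / 4` once `2 * (k + 1) <
    -- N / 32`. The growing gaps between levels provide this.
    have h4 : 64 * (k + 1) < N := by
      have : k + 1 < 2 ^ (2 * k + 1) := by
        have : 2 * k + 1 < 2 ^ (2 * k + 1) := Nat.lt_two_pow_self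
        rcases k with _ | k
        · norm_num
        · omega
      rw [hN, show 2 * k + 7 = 2 * k + 1 + 6 by ring, pow_add]; omega
    have h5 : (64 : ℝ) * (k + 1) < N := by exact_mod_cast h4
    have h6 : (4 : ℝ) * C.card = N := by rw [hCcard]; exact_mod_cast hNdvd
    have : (K.card : ℝ) < C.card := by linarith
    exact_mod_cast this
  obtain ⟨j, hjC, hjK⟩ : ∃ j ∈ C, j ∉ K := Finset.exists_mem_notMem_of_card_lt_card hKcard
  obtain ⟨i, hi, rfl⟩ := Finset.mem_image.1 hjC
  have hiN : 4 * i + 1 < N := by have := Finset.mem_range.1 hi; omega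
  have hj1 : (m * N + (4 * i + 1)) / N = m := by
    rw [mul_comm, Nat.mul_add_div hNpos, Nat.div_eq_of_lt hiN, add_zero]
  refine ⟨_, ?_, hj1, ?_⟩
  · have : m * N = 4 * (m * (N / 4)) := by rw [← hNdvd]; simp; ring
    omega
  intro e n hn h1 h2
  by_contra hlt
  push Not at hlt
  apply hjK
  have hgap : 1 ≤ lag e * (b e (n + 1) - b e n) := by rw [hbj]; linarith
  have hj : (((m * N + (4 * i + 1) : ℕ)) : ℝ) + 1 ≤ (m + 1) * N := by
    have : m * N + (4 * i + 1) + 1 ≤ (m + 1) * N := by rw [add_mul]; omega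
    exact_mod_cast this
  have hj' : (m : ℝ) * N ≤ ((m * N + (4 * i + 1) : ℕ) : ℝ) := by
    exact_mod_cast Nat.le_add_right _ _
  have h2' : ((m * N + (4 * i + 1) : ℕ) : ℝ)
      < b e (n + 1) + lag e ^ 2 * (b e (n + 1) - b e n) := by
    rw [hbj]; simp only [hb]; linarith
  -- A sequence with `e ≥ k + 1` has steps no longer than a cell of level `k + 1`, so it cannot
  -- spoil the child.
  have hek : e < k + 1 := by
    by_contra hge
    push Not at hge
    have hle : (2 : ℝ) ^ level (k + 1) ≤ 2 ^ level e :=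
      pow_le_pow_right₀ (by norm_num) (level_strictMono.monotone hge)
    have hp : 0 < a e (n + 1) - a e n := by linarith [hpos e n hn]
    have h3 : (a e (n + 1) - a e n) * 2 ^ level (k + 1) ≤ 1 :=
      le_trans (mul_le_mul_of_nonneg_left hle hp.le) (hsmall e n hn)
    have h4 := lag_lt_one e
    have h5 : 0 < (a e (n + 1) - a e n) * 2 ^ level (k + 1) := by positivity
    rw [mul_assoc] at hlt
    nlinarith [lag_pos e]
  simp only [K, G, Finset.mem_biUnion, Finset.mem_filter, Finset.mem_range]
  exact ⟨e, hek, n, ⟨hn, hgap, lt_of_lt_of_le h1 hj, lt_of_le_of_lt hj' h2'⟩, hjC, h2', h1⟩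

theorem exists_goodCell {a : ℕ → ℕ → ℝ} {F : ℕ → Finset ℕ}
    (hord : ∀ e, ∀ n ∈ F e, ∀ n' ∈ F e, n < n' → a e (n + 1) ≤ a e n')
    (hpos : ∀ e, ∀ n ∈ F e, a e n < a e (n + 1))
    (hsmall : ∀ e, ∀ n ∈ F e, (a e (n + 1) - a e n) * 2 ^ level e ≤ 1) (k : ℕ) :
    ∃ m, m < 2 ^ level k ∧ (∀ i ≤ k, m * 2 ^ level i / 2 ^ level k % 4 = 1) ∧
      GoodCell a F k m := by
  induction k with
  | zero =>
    refine ⟨1, by norm_num [level], ?_, ?_⟩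
    · intro i hi
      obtain rfl : i = 0 := by omega
      simp
    · intro e n hn _ _
      have hle : (2 : ℝ) ^ level 0 ≤ 2 ^ level e :=
        pow_le_pow_right₀ (by norm_num) (level_strictMono.monotone (Nat.zero_le e))
      have hp : 0 < a e (n + 1) - a e n := by linarith [hpos e n hn]
      have h3 : (a e (n + 1) - a e n) * 2 ^ level 0 ≤ 1 :=
        le_trans (mul_le_mul_of_nonneg_left hle hp.le) (hsmall e n hn)
      have h5 : 0 < (a e (n + 1) - a e n) * 2 ^ level 0 := by positivity
      rw [mul_assoc]
      nlinarith [lag_lt_one e, lag_pos e]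
  | succ k ih =>
    obtain ⟨m, hm, hmod, hgood⟩ := ih
    obtain ⟨j, hj, hjm, hjgood⟩ := exists_goodCell_child hord hpos hsmall hgood
    refine ⟨j, ?_, ?_, hjgood⟩
    · rw [level_succ, pow_add, ← Nat.div_lt_iff_lt_mul (by positivity), hjm]
      exact hm
    · intro i hi
      rcases Nat.lt_or_ge i (k + 1) with h | h
      · have hmi := hmod i (by omega)
        have hle : level i ≤ level k := level_strictMono.monotone (by omega)
        obtain ⟨t, ht⟩ := Nat.exists_eq_add_of_le hle
        rw [ht, pow_add, mul_comm, Nat.mul_div_mul_left _ _ (by positivity)] at hmi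
        rw [level_succ, ht, add_assoc, pow_add, mul_comm,
          Nat.mul_div_mul_left _ _ (by positivity), add_comm t, pow_add, ← Nat.div_div_eq_div_mul,
          hjm]
        exact hmi
      · obtain rfl : i = k + 1 := by omega
        rw [Nat.mul_div_cancel _ (by positivity)]
        exact hj

/-! ### Decidability of the allowed cells -/

theorem PrimrecRel.bforall_lt {α : Type*} [Primcodable α] {p : α → ℕ → Prop} {f : α → ℕ}
    (hp : PrimrecRel p) (hf : Primrec f) : PrimrecPred fun a => ∀ i < f a, p a i :=
  ((PrimrecRel.forall_mem_list hp.swap).comp (Primrec.list_range.comp hf) Primrec.id).of_eq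
    (by simp [Function.swap])

theorem Primrec.nat_pow {α : Type*} [Primcodable α] {f g : α → ℕ} (hf : Primrec f)
    (hg : Primrec g) : Primrec fun a => f a ^ g a :=
  (Primrec₂.unpaired'.1 Nat.Primrec.pow).comp hf hg

theorem computable_of_isLeast {α : Type*} [Primcodable α] {p : α → ℕ → Prop} [DecidableRel p]
    (hp : Computable₂ fun a m => decide (p a m)) {f : α → ℕ}
    (hf : ∀ a, IsLeast {m | p a m} (f a)) : Computable f := by
  have h : Partrec fun a => Nat.rfind fun m => (Part.some (decide (p a m)) : Part Bool) :=
    Partrec.rfind hp.partrec₂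
  refine Partrec.of_eq h fun a => ?_
  refine Part.eq_some_iff.2 (Nat.mem_rfind.2 ⟨?_, fun {m} hm => ?_⟩)
  · have : p a (f a) := (hf a).1
    simpa using this
  · have : ¬ p a m := fun h => absurd ((hf a).2 h) (not_le.2 hm)
    simpa using this

/-- The rational number coded by `v`. -/
noncomputable def ratOf (v : ℕ) : ℝ := (v.unpair.1 : ℝ) / ((v.unpair.2 : ℝ) + 1)

/-- The value at `i` of the `e`-th partial computable function, as far as it is known by
stage `s`. -/
def guess (e s i : ℕ) : Option ℕ :=
  Nat.Partrec.Code.evaln s (Denumerable.ofNat Nat.Partrec.Code e) i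

def guessVal (e s i : ℕ) : ℕ := (guess e s i).getD 0

noncomputable def approx (e s i : ℕ) : ℝ := ratOf (guessVal e s i)

/-- `incr` over the whole initial segment makes the steps disjoint; `short` keeps sequence `e` from
acting before level `e`, and discards only finitely many steps of a convergent sequence. -/
structure ValidStep (e s n : ℕ) : Prop where
  conv : ∀ i < n + 2, (guess e s i).isSome
  incr : ∀ i < n + 1, approx e s i < approx e s (i + 1)
  short : (approx e s (n + 1) - approx e s n) * 2 ^ level e ≤ 1

/-- The cell `[m, m + 1] * 2 ^ (-l)` lies strictly between `approx e s (n + 1)` and the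
point that exceeds it by `lag e ^ 2` times the length of the preceding step. -/
def Covers (e s n l m : ℕ) : Prop :=
  approx e s (n + 1) * 2 ^ l < m ∧
    (m : ℝ) + 1 < (approx e s (n + 1) + lag e ^ 2 * (approx e s (n + 1) - approx e s n)) * 2 ^ l

def Allowed (s m : ℕ) : Prop :=
  (∀ i < s + 1, m * 2 ^ level i / 2 ^ level s % 4 = 1) ∧
    ∀ e < s, ∀ n < s, ¬ (ValidStep e s n ∧ Covers e s n (level s) m)

theorem primrec_level : Primrec level := Primrec.nat_pow
  (Primrec.nat_add.comp Primrec.id (Primrec.const 3)) (Primrec.const 2)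

theorem primrec_guess : Primrec fun x : (ℕ × ℕ) × ℕ => guess x.1.1 x.1.2 x.2 :=
  Nat.Partrec.Code.primrec_evaln.comp
    (((Primrec.snd.comp Primrec.fst).pair
      ((Primrec.ofNat _).comp (Primrec.fst.comp Primrec.fst))).pair Primrec.snd)

section
variable {α : Type*} [Primcodable α] {e s n l m : α → ℕ}

theorem Primrec.guess (he : Primrec e) (hs : Primrec s) (hn : Primrec n) :
    Primrec fun a => guess (e a) (s a) (n a) :=
  primrec_guess.comp ((he.pair hs).pair hn)

theorem Primrec.guessVal (he : Primrec e) (hs : Primrec s) (hn : Primrec n) :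
    Primrec fun a => guessVal (e a) (s a) (n a) :=
  Primrec.option_getD.comp (he.guess hs hn) (Primrec.const 0)

theorem Primrec.numer {v : α → ℕ} (hv : Primrec v) : Primrec fun a => (v a).unpair.1 :=
  Primrec.fst.comp (Primrec.unpair.comp hv)

theorem Primrec.denom {v : α → ℕ} (hv : Primrec v) : Primrec fun a => (v a).unpair.2 + 1 :=
  Primrec.succ.comp (Primrec.snd.comp (Primrec.unpair.comp hv))

/-- Clearing denominators turns this and the next comparisons into inequalities in `ℕ`, which are
primitive recursive. -/
theorem ratOf_lt_iff (v w : ℕ) : ratOf v < ratOf w ↔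
    v.unpair.1 * (w.unpair.2 + 1) < w.unpair.1 * (v.unpair.2 + 1) := by
  unfold ratOf
  rw [div_lt_div_iff₀ (by positivity) (by positivity)]
  norm_cast

theorem ratOf_short_iff (v w l : ℕ) : (ratOf w - ratOf v) * 2 ^ l ≤ 1 ↔
    w.unpair.1 * (v.unpair.2 + 1) * 2 ^ l ≤
      (v.unpair.2 + 1) * (w.unpair.2 + 1) + v.unpair.1 * (w.unpair.2 + 1) * 2 ^ l := by
  unfold ratOf
  have h : ∀ p q r t : ℝ, 0 < q → 0 < t →
      ((r / t - p / q) * 2 ^ l ≤ 1 ↔ r * q * 2 ^ l ≤ q * t + p * t * 2 ^ l) := by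
    intro p q r t hq ht
    rw [show (r / t - p / q) * 2 ^ l = (r * q * 2 ^ l - p * t * 2 ^ l) / (q * t) by
      field_simp, div_le_one (by positivity), sub_le_iff_le_add]
  rw [h _ _ _ _ (by positivity) (by positivity)]
  norm_cast

theorem ratOf_mul_lt_iff (v l m : ℕ) : ratOf v * 2 ^ l < m ↔
    v.unpair.1 * 2 ^ l < m * (v.unpair.2 + 1) := by
  unfold ratOf
  rw [div_mul_eq_mul_div, div_lt_iff₀ (by positivity)]
  norm_cast

theorem ratOf_overshoot_iff (v w e l m : ℕ) :
    (m : ℝ) + 1 < (ratOf w + lag e ^ 2 * (ratOf w - ratOf v)) * 2 ^ l ↔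
    (m + 1) * 2 ^ (2 * e + 12) * ((v.unpair.2 + 1) * (w.unpair.2 + 1))
        + v.unpair.1 * (w.unpair.2 + 1) * 2 ^ l <
      w.unpair.1 * (v.unpair.2 + 1) * 2 ^ l * (2 ^ (2 * e + 12) + 1) := by
  unfold ratOf lag
  have h : ∀ p q r t E : ℝ, 0 < q → 0 < t → 0 < E →
      ((m : ℝ) + 1 < (r / t + E⁻¹ * (r / t - p / q)) * 2 ^ l ↔
        (m + 1) * E * (q * t) + p * t * 2 ^ l < r * q * 2 ^ l * (E + 1)) := by
    intro p q r t E hq ht hE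
    rw [show (r / t + E⁻¹ * (r / t - p / q)) * 2 ^ l =
      (r * q * 2 ^ l * (E + 1) - p * t * 2 ^ l) / (E * (q * t)) by field_simp; ring,
      lt_div_iff₀ (by positivity), lt_sub_iff_add_lt, mul_assoc ((m : ℝ) + 1)]
  rw [show (((1 : ℝ) / 2) ^ (e + 6)) ^ 2 = (2 ^ (2 * e + 12))⁻¹ by
      rw [← pow_mul, one_div, inv_pow]; congr 2; ring,
    h _ _ _ _ _ (by positivity) (by positivity) (by positivity)]
  norm_cast

theorem primrecPred_validStep (he : Primrec e) (hs : Primrec s) (hn : Primrec n) :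
    PrimrecPred fun a => ValidStep (e a) (s a) (n a) := by
  have add := @Primrec.nat_add
  have mul := @Primrec.nat_mul
  have one : Primrec fun _ : α => 1 := Primrec.const 1
  have two : Primrec fun _ : α => 2 := Primrec.const 2
  have hv := he.guessVal hs hn
  have hw := he.guessVal hs (add.comp hn one)
  have hpow := two.nat_pow (primrec_level.comp he)
  have h1 : PrimrecPred fun a => ∀ i < n a + 2, (guess (e a) (s a) i).isSome :=
    PrimrecRel.bforall_lt (p := fun a i => (_root_.guess (e a) (s a) i).isSome = true)
      (Primrec.eq.comp (Primrec.option_isSome.comp (Primrec.guess (he.comp Primrec.fst)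
        (hs.comp Primrec.fst) Primrec.snd)) (Primrec.const true))
      (add.comp hn two)
  have h2 : PrimrecPred fun a => ∀ i < n a + 1, approx (e a) (s a) i < approx (e a) (s a) (i + 1) := by
    refine PrimrecRel.bforall_lt (p := fun a i => approx (e a) (s a) i < approx (e a) (s a) (i + 1))
      ?_ (add.comp hn one)
    have hv := Primrec.guessVal (he.comp Primrec.fst) (hs.comp Primrec.fst)
      (Primrec.snd (α := α) (β := ℕ))
    have hw := Primrec.guessVal (he.comp Primrec.fst) (hs.comp Primrec.fst)
      (Primrec.succ.comp (Primrec.snd (α := α) (β := ℕ)))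
    exact PrimrecPred.of_eq (Primrec.nat_lt.comp (mul.comp hv.numer hw.denom)
      (mul.comp hw.numer hv.denom)) fun a => (ratOf_lt_iff _ _).symm
  have h3 : PrimrecPred fun a =>
      (approx (e a) (s a) (n a + 1) - approx (e a) (s a) (n a)) * 2 ^ level (e a) ≤ 1 :=
    PrimrecPred.of_eq (Primrec.nat_le.comp (mul.comp (mul.comp hw.numer hv.denom) hpow)
      (add.comp (mul.comp hv.denom hw.denom) (mul.comp (mul.comp hv.numer hw.denom) hpow)))
      fun a => (ratOf_short_iff _ _ _).symm
  exact (h1.and (h2.and h3)).of_eq fun a => ⟨fun h => ⟨h.1, h.2.1, h.2.2⟩,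
    fun h => ⟨h.conv, h.incr, h.short⟩⟩

theorem primrecPred_covers (he : Primrec e) (hs : Primrec s) (hn : Primrec n) (hl : Primrec l)
    (hm : Primrec m) : PrimrecPred fun a => Covers (e a) (s a) (n a) (l a) (m a) := by
  have add := @Primrec.nat_add
  have mul := @Primrec.nat_mul
  have two : Primrec fun _ : α => 2 := Primrec.const 2
  have hv := he.guessVal hs hn
  have hw := he.guessVal hs (Primrec.succ.comp hn)
  have hpow := two.nat_pow hl
  have hE := two.nat_pow (add.comp (mul.comp two he) (Primrec.const 12))
  have h1 : PrimrecPred fun a => approx (e a) (s a) (n a + 1) * 2 ^ l a < m a :=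
    PrimrecPred.of_eq (Primrec.nat_lt.comp (mul.comp hw.numer hpow) (mul.comp hm hw.denom))
      fun a => (ratOf_mul_lt_iff _ _ _).symm
  refine h1.and (PrimrecPred.of_eq (Primrec.nat_lt.comp
    (add.comp (mul.comp (mul.comp (Primrec.succ.comp hm) hE) (mul.comp hv.denom hw.denom))
      (mul.comp (mul.comp hv.numer hw.denom) hpow))
    (mul.comp (mul.comp (mul.comp hw.numer hv.denom) hpow) (Primrec.succ.comp hE)))
    fun a => (ratOf_overshoot_iff _ _ _ _ _).symm)

end

theorem primrecRel_allowed : PrimrecRel Allowed := by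
  have hs : Primrec fun x : ℕ × ℕ => x.1 := Primrec.fst
  have h1 : PrimrecPred fun x : ℕ × ℕ =>
      ∀ i < x.1 + 1, x.2 * 2 ^ level i / 2 ^ level x.1 % 4 = 1 := by
    refine PrimrecRel.bforall_lt
      (p := fun (x : ℕ × ℕ) i => x.2 * 2 ^ level i / 2 ^ level x.1 % 4 = 1) ?_
      (Primrec.succ.comp hs)
    have hpow : Primrec fun k => 2 ^ level k := (Primrec.const 2).nat_pow primrec_level
    exact Primrec.eq.comp (Primrec.nat_mod.comp (Primrec.nat_div.comp
      (Primrec.nat_mul.comp (Primrec.snd.comp Primrec.fst) (hpow.comp Primrec.snd))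
      (hpow.comp (Primrec.fst.comp Primrec.fst))) (Primrec.const 4)) (Primrec.const 1)
  have h2 : PrimrecPred fun x : ℕ × ℕ =>
      ∀ e < x.1, ∀ n < x.1, ¬ (ValidStep e x.1 n ∧ Covers e x.1 n (level x.1) x.2) := by
    refine PrimrecRel.bforall_lt (p := fun (x : ℕ × ℕ) e =>
      ∀ n < x.1, ¬ (ValidStep e x.1 n ∧ Covers e x.1 n (level x.1) x.2)) ?_ hs
    refine PrimrecRel.bforall_lt (p := fun (y : (ℕ × ℕ) × ℕ) n =>
      ¬ (ValidStep y.2 y.1.1 n ∧ Covers y.2 y.1.1 n (level y.1.1) y.1.2)) ?_ (hs.comp Primrec.fst)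
    have hstage : Primrec fun z : ((ℕ × ℕ) × ℕ) × ℕ => z.1.1.1 :=
      hs.comp (Primrec.fst.comp Primrec.fst)
    have hcell : Primrec fun z : ((ℕ × ℕ) × ℕ) × ℕ => z.1.1.2 :=
      Primrec.snd.comp (Primrec.fst.comp Primrec.fst)
    have hidx : Primrec fun z : ((ℕ × ℕ) × ℕ) × ℕ => z.1.2 := Primrec.snd.comp Primrec.fst
    exact ((primrecPred_validStep hidx hstage Primrec.snd).and
      (primrecPred_covers hidx hstage Primrec.snd (primrec_level.comp hstage) hcell)).not
  exact h1.and h2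

/-! ### Leftmost allowed cells -/

theorem guess_mono {e s t i v : ℕ} (hst : s ≤ t) (h : guess e s i = some v) :
    guess e t i = some v :=
  Nat.Partrec.Code.evaln_mono hst h

theorem guessVal_eq {e s t i : ℕ} (hst : s ≤ t) (h : (guess e s i).isSome) :
    guessVal e t i = guessVal e s i := by
  obtain ⟨v, hv⟩ := Option.isSome_iff_exists.1 h
  rw [guessVal, guessVal, guess_mono hst hv, hv]

theorem ValidStep.approx_eq {e s t n i : ℕ} (h : ValidStep e s n) (hst : s ≤ t) (hi : i < n + 2) :
    approx e t i = approx e s i := by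
  rw [approx, approx, guessVal_eq hst (h.conv i hi)]

theorem ValidStep.mono {e s t n : ℕ} (h : ValidStep e s n) (hst : s ≤ t) : ValidStep e t n where
  conv i hi := by
    obtain ⟨v, hv⟩ := Option.isSome_iff_exists.1 (h.conv i hi)
    rw [guess_mono hst hv]; rfl
  incr i hi := by
    rw [h.approx_eq hst (by omega), h.approx_eq hst (by omega)]
    exact h.incr i hi
  short := by
    rw [h.approx_eq hst (by omega), h.approx_eq hst (by omega)]
    exact h.short

theorem ValidStep.approx_le {e s n i j : ℕ} (h : ValidStep e s n) (hij : i ≤ j) (hj : j ≤ n + 1) :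
    approx e s i ≤ approx e s j := by
  induction j, hij using Nat.le_induction with
  | base => exact le_rfl
  | succ j _ ih => exact (ih (by omega)).trans (h.incr j (by omega)).le

theorem exists_allowed (s : ℕ) : ∃ m, m < 2 ^ level s ∧ Allowed s m := by
  classical
  let F : ℕ → Finset ℕ := fun e => (Finset.range s).filter fun n => ValidStep e s n
  have hF : ∀ e, ∀ n ∈ F e, ValidStep e s n := fun e n hn => (Finset.mem_filter.1 hn).2
  obtain ⟨m, hm, hmod, hgood⟩ := exists_goodCell (a := fun e n => approx e s n) (F := F)
    (fun e n _ n' hn' h => (hF e n' hn').approx_le h (by omega))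
    (fun e n hn => (hF e n hn).incr n (by omega)) (fun e n hn => (hF e n hn).short) s
  refine ⟨m, hm, fun i hi => hmod i (by omega), fun e _ n hn ⟨hv, h1, h2⟩ => ?_⟩
  -- A covered cell would force `lag e ^ 2 * step > 1` in cell units, whereas goodness gives `lag e
  -- * step < 1`.
  have h3 := hgood e n (Finset.mem_filter.2 ⟨Finset.mem_range.2 hn, hv⟩) (by linarith)
    (by linarith)
  have h4 : 0 < (approx e s (n + 1) - approx e s n) * 2 ^ level s :=
    mul_pos (sub_pos.2 (hv.incr n (by omega))) (by positivity)
  rw [mul_assoc] at h3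
  have h5 : lag e ^ 2 * ((approx e s (n + 1) - approx e s n) * 2 ^ level s) < 1 := by
    rw [sq, mul_assoc]
    nlinarith [lag_pos e, lag_lt_one e]
  linarith

open Classical in
/-- The leftmost allowed cell at level `s`. -/
noncomputable def leastCell (s : ℕ) : ℕ := Nat.find ((exists_allowed s).imp fun _ h => h.2)

theorem isLeast_leastCell (s : ℕ) : IsLeast {m | Allowed s m} (leastCell s) := by
  classical
  exact ⟨Nat.find_spec ((exists_allowed s).imp fun _ h => h.2), fun m hm => Nat.find_min' _ hm⟩

theorem leastCell_lt (s : ℕ) : leastCell s < 2 ^ level s := by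
  obtain ⟨m, hm, hA⟩ := exists_allowed s
  exact ((isLeast_leastCell s).2 hA).trans_lt hm

theorem computable_leastCell : Computable leastCell := by
  classical
  exact computable_of_isLeast primrecRel_allowed.decide.to_comp isLeast_leastCell

/-! ### Truncations and the limit point -/

/-- The integer part of `2 ^ level k` times the left end point of the cell `leastCell s`. -/
noncomputable def trunc (s k : ℕ) : ℕ := leastCell s * 2 ^ level k / 2 ^ level s

theorem mul_pow_div_pow_eq (M l : ℕ) {j k : ℕ} (hjk : j ≤ k) :
    M * 2 ^ j / 2 ^ l = M * 2 ^ k / 2 ^ l / 2 ^ (k - j) := by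
  obtain ⟨c, rfl⟩ := Nat.exists_eq_add_of_le hjk
  rw [Nat.add_sub_cancel_left, Nat.div_div_eq_div_mul, pow_add, ← mul_assoc,
    Nat.mul_div_mul_right _ _ (by positivity)]

/-- Valid steps persist to later stages, and an interval covering a cell covers its children. Hence
leftmost cells can only move right. -/
theorem Allowed.div {s m : ℕ} (h : Allowed (s + 1) m) : Allowed s (m / 2 ^ (2 * s + 7)) := by
  constructor
  · intro i hi
    have h1 := h.1 i (by omega)
    have hil : level i ≤ level s := level_strictMono.monotone (by omega)
    rw [mul_pow_div_pow_eq _ _ (hil.trans (level_strictMono.monotone s.le_succ)),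
      Nat.mul_div_cancel _ (by positivity)] at h1
    rw [mul_pow_div_pow_eq _ _ hil, Nat.mul_div_cancel _ (by positivity),
      Nat.div_div_eq_div_mul, ← pow_add]
    rw [level_succ] at h1
    rwa [show 2 * s + 7 + (level s - level i) = level s + (2 * s + 7) - level i by omega]
  · intro e he n hn ⟨hv, h1, h2⟩
    refine h.2 e (by omega) n (by omega) ⟨hv.mono s.le_succ, ?_⟩
    unfold Covers
    rw [hv.approx_eq s.le_succ (by omega), hv.approx_eq s.le_succ (by omega), level_succ, pow_add,
      ← mul_assoc, ← mul_assoc]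
    have hpos : (0 : ℝ) < 2 ^ (2 * s + 7) := by positivity
    have h3 : ((m / 2 ^ (2 * s + 7) : ℕ) : ℝ) * 2 ^ (2 * s + 7) ≤ m := by
      exact_mod_cast Nat.div_mul_le_self _ _
    have h4 : (m : ℝ) + 1 ≤ (((m / 2 ^ (2 * s + 7) : ℕ) : ℝ) + 1) * 2 ^ (2 * s + 7) := by
      exact_mod_cast Nat.lt_div_mul_add (a := m) (show 0 < 2 ^ (2 * s + 7) by positivity)
        |>.trans_eq (by ring)
    exact ⟨(mul_lt_mul_of_pos_right h1 hpos).trans_le h3,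
      h4.trans_lt (mul_lt_mul_of_pos_right h2 hpos)⟩

noncomputable def leftEnd (s : ℕ) : ℝ := leastCell s / 2 ^ level s

theorem leftEnd_mul_pow (s k : ℕ) :
    leftEnd s * 2 ^ level k = ((leastCell s * 2 ^ level k : ℕ) : ℝ) / ((2 ^ level s : ℕ) : ℝ) := by
  unfold leftEnd; push_cast; ring

theorem trunc_eq_floor (s k : ℕ) : trunc s k = ⌊leftEnd s * 2 ^ level k⌋₊ := by
  rw [leftEnd_mul_pow, Nat.floor_div_eq_div, trunc]

theorem leftEnd_nonneg (s : ℕ) : 0 ≤ leftEnd s := by unfold leftEnd; positivity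

theorem trunc_le (s k : ℕ) : (trunc s k : ℝ) ≤ leftEnd s * 2 ^ level k := by
  rw [trunc_eq_floor]
  exact Nat.floor_le (mul_nonneg (leftEnd_nonneg s) (by positivity))

theorem lt_trunc_add_one (s k : ℕ) : leftEnd s * 2 ^ level k < trunc s k + 1 := by
  rw [trunc_eq_floor]
  exact Nat.lt_floor_add_one _

theorem trunc_mod_four {s k : ℕ} (h : k ≤ s) : trunc s k % 4 = 1 :=
  (isLeast_leastCell s).1.1 k (by omega)

theorem leftEnd_mul_level_self (s : ℕ) : leftEnd s * 2 ^ level s = leastCell s := by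
  unfold leftEnd; field_simp

theorem trunc_self (s : ℕ) : trunc s s = leastCell s := by
  rw [trunc, Nat.mul_div_cancel _ (by positivity)]

theorem trunc_succ (s : ℕ) : trunc s (s + 1) = leastCell s * 2 ^ (2 * s + 7) := by
  rw [trunc, level_succ, pow_add, mul_left_comm, Nat.mul_div_cancel_left _ (by positivity)]

theorem leftEnd_mul_level_succ (s : ℕ) : leftEnd s * 2 ^ level (s + 1) = trunc s (s + 1) := by
  rw [trunc_succ, level_succ, pow_add, ← mul_assoc, leftEnd_mul_level_self]
  push_cast; rfl

theorem trunc_succ_lt (s : ℕ) : trunc s (s + 1) < trunc (s + 1) (s + 1) := by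
  have h1 : leastCell s ≤ leastCell (s + 1) / 2 ^ (2 * s + 7) :=
    (isLeast_leastCell s).2 (isLeast_leastCell (s + 1)).1.div
  have h3 : trunc s (s + 1) ≤ leastCell (s + 1) := by
    rw [trunc_succ]; exact (Nat.mul_le_mul_right _ h1).trans (Nat.div_mul_le_self _ _)
  -- Equality is excluded modulo 4: the new cell is 1, while the old left end point is 0 at the
  -- finer level.
  have h4 := trunc_mod_four (le_refl (s + 1))
  have h5 : trunc s (s + 1) % 4 = 0 := by
    rw [trunc_succ, show 2 * s + 7 = 2 * s + 5 + 2 by ring, pow_add, ← mul_assoc]; omega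
  rw [trunc_self] at *
  refine lt_of_le_of_ne h3 fun h => ?_
  omega

theorem leftEnd_strictMono : StrictMono leftEnd := by
  refine strictMono_nat_of_lt_succ fun s => ?_
  have h : (trunc s (s + 1) : ℝ) < trunc (s + 1) (s + 1) := by exact_mod_cast trunc_succ_lt s
  rw [← leftEnd_mul_level_succ, trunc_self, ← leftEnd_mul_level_self] at h
  exact lt_of_mul_lt_mul_right h (by positivity)

theorem trunc_mono {s t : ℕ} (h : s ≤ t) (k : ℕ) : trunc s k ≤ trunc t k := by
  rw [trunc_eq_floor, trunc_eq_floor]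
  exact Nat.floor_le_floor (mul_le_mul_of_nonneg_right (leftEnd_strictMono.monotone h)
    (by positivity))

theorem leftEnd_lt_one (s : ℕ) : leftEnd s < 1 := by
  unfold leftEnd
  rw [div_lt_one (by positivity)]
  exact_mod_cast leastCell_lt s

/-- The limit of the leftmost allowed cells. -/
noncomputable def leftmostPoint : ℝ := ⨆ s, leftEnd s

theorem bddAbove_leftEnd : BddAbove (Set.range leftEnd) :=
  ⟨1, by rintro _ ⟨s, rfl⟩; exact (leftEnd_lt_one s).le⟩

theorem tendsto_leftEnd : Tendsto leftEnd atTop (𝓝 leftmostPoint) :=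
  tendsto_atTop_ciSup leftEnd_strictMono.monotone bddAbove_leftEnd

theorem leftEnd_lt_leftmostPoint (s : ℕ) : leftEnd s < leftmostPoint :=
  (leftEnd_strictMono s.lt_succ_self).trans_le (le_ciSup bddAbove_leftEnd (s + 1))

theorem leftmostPoint_pos : 0 < leftmostPoint := (leftEnd_nonneg 0).trans_lt (leftEnd_lt_leftmostPoint 0)

theorem leftmostPoint_mem_Icc : leftmostPoint ∈ Set.Icc (0 : ℝ) 1 :=
  ⟨leftmostPoint_pos.le, ciSup_le fun s => (leftEnd_lt_one s).le⟩

theorem exists_cell_le (k : ℕ) : ∃ m : ℕ, m % 4 = 1 ∧ (m : ℝ) < leftmostPoint * 2 ^ level k ∧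
    leftmostPoint * 2 ^ level k ≤ m + 1 ∧ ∀ᶠ s in atTop, trunc s k = m := by
  set t := leftmostPoint * 2 ^ level k with ht
  have ht0 : 0 < t := mul_pos leftmostPoint_pos (by positivity)
  -- The limit is approached strictly from below, so the final truncation is `⌈t⌉₊ - 1` rather than
  -- the floor.
  have hc : 0 < ⌈t⌉₊ := Nat.ceil_pos.2 ht0
  obtain ⟨m, hm⟩ := Nat.exists_eq_succ_of_ne_zero hc.ne'
  have h1 : (m : ℝ) < t := Nat.lt_ceil.1 (by omega)
  have h2 : t ≤ m + 1 := by
    have := Nat.le_ceil t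
    rw [hm] at this
    exact_mod_cast this
  have hev : ∀ᶠ s in atTop, trunc s k = m := by
    have hlim : Tendsto (fun s => leftEnd s * 2 ^ level k) atTop (𝓝 t) :=
      tendsto_leftEnd.mul_const _
    filter_upwards [hlim.eventually_const_lt h1] with s hs
    rw [trunc_eq_floor, Nat.floor_eq_iff (mul_nonneg (leftEnd_nonneg s) (by positivity))]
    refine ⟨hs.le, lt_of_lt_of_le ?_ h2⟩
    exact mul_lt_mul_of_pos_right (leftEnd_lt_leftmostPoint s) (by positivity)
  obtain ⟨s, hs, hks⟩ := (hev.and (eventually_ge_atTop k)).exists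
  exact ⟨m, hs ▸ trunc_mod_four hks, h1, h2, hev⟩

theorem exists_cell (k : ℕ) : ∃ m : ℕ, m % 4 = 1 ∧ (m : ℝ) < leftmostPoint * 2 ^ level k ∧
    leftmostPoint * 2 ^ level k < m + 1 ∧ ∀ᶠ s in atTop, trunc s k = m := by
  obtain ⟨m, h0, h1, h2, h3⟩ := exists_cell_le k
  refine ⟨m, h0, h1, lt_of_le_of_ne h2 fun heq => ?_, h3⟩
  -- If the limit were the right end point of its cell, its cell one level finer would be the last
  -- child, which is 3 mod 4.
  obtain ⟨m', h0', h1', h2', -⟩ := exists_cell_le (k + 1)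
  rw [level_succ, pow_add, ← mul_assoc, heq] at h1' h2'
  have h4 : m' < (m + 1) * 2 ^ (2 * k + 7) := by exact_mod_cast h1'
  have h5 : (m + 1) * 2 ^ (2 * k + 7) ≤ m' + 1 := by exact_mod_cast h2'
  have h6 : (m + 1) * 2 ^ (2 * k + 7) = 4 * ((m + 1) * 2 ^ (2 * k + 5)) := by ring
  omega

/-! ### Non-immunity -/

/-- `N` is read off from the first `l + 1` digits. Both bounds are non-strict so that either
expansion of a dyadic rational is covered. -/
theorem exists_nat_add_eq_realOfSet_mul (A : Set ℕ) (l : ℕ) : ∃ N : ℕ, (l ∉ A → N % 2 = 0) ∧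
    (N : ℝ) ≤ realOfSet A * 2 ^ (l + 1) ∧ realOfSet A * 2 ^ (l + 1) ≤ N + 1 := by
  classical
  set f : ℕ → ℝ := A.indicator fun n => ((1 : ℝ) / 2) ^ (n + 1)
  have hg : HasSum (fun n : ℕ => ((1 : ℝ) / 2) ^ (n + 1)) 1 := by
    have := hasSum_geometric_two.mul_right ((1 : ℝ) / 2)
    rw [show (2 : ℝ) * (1 / 2) = 1 by norm_num] at this
    simpa only [pow_succ] using this
  have hf0 : ∀ n, 0 ≤ f n := fun n => Set.indicator_nonneg (fun _ _ => by positivity) n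
  have hfle : ∀ n, f n ≤ (1 / 2) ^ (n + 1) := fun n =>
    Set.indicator_le_self' (fun _ _ => by positivity) n
  have hf : Summable f := Summable.of_nonneg_of_le hf0 hfle hg.summable
  have hsplit : realOfSet A = ∑ n ∈ Finset.range (l + 1), f n + ∑' n, f (n + (l + 1)) :=
    (hf.sum_add_tsum_nat_add (l + 1)).symm
  have htail0 : 0 ≤ ∑' n, f (n + (l + 1)) := tsum_nonneg fun n => hf0 _
  have htail1 : ∑' n, f (n + (l + 1)) ≤ (1 / 2) ^ (l + 1) := by
    have h2 : HasSum (fun n : ℕ => ((1 : ℝ) / 2) ^ (n + (l + 1) + 1)) ((1 / 2) ^ (l + 1)) := by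
      have := hg.mul_right ((1 / 2) ^ (l + 1))
      rw [one_mul] at this
      refine this.congr_fun fun n => ?_
      ring
    exact (((summable_nat_add_iff (l + 1)).2 hf).tsum_le_tsum (fun n => hfle _) h2.summable).trans_eq
      h2.tsum_eq
  have hpow : (1 / 2 : ℝ) ^ (l + 1) * 2 ^ (l + 1) = 1 := by
    rw [← mul_pow]; norm_num
  set N : ℕ := ∑ n ∈ Finset.range (l + 1), if n ∈ A then 2 ^ (l - n) else 0
  have hN : (N : ℝ) = (∑ n ∈ Finset.range (l + 1), f n) * 2 ^ (l + 1) := by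
    rw [Finset.sum_mul, Nat.cast_sum]
    refine Finset.sum_congr rfl fun n hn => ?_
    have hnl : n ≤ l := by have := Finset.mem_range.1 hn; omega
    by_cases h : n ∈ A
    · simp only [f, h, if_true, Set.indicator_of_mem]
      rw [show (2 : ℝ) ^ (l + 1) = 2 ^ (l - n) * 2 ^ (n + 1) by rw [← pow_add]; congr 1; omega,
        mul_left_comm, ← mul_pow]
      norm_num
    · simp [f, h]
  refine ⟨N, fun hl => ?_, ?_, ?_⟩
  · simp only [N, Finset.sum_range_succ, if_neg hl, add_zero]
    refine Nat.mod_eq_zero_of_dvd (Finset.dvd_sum fun n hn => ?_)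
    split_ifs
    · exact dvd_pow_self 2 (by have := Finset.mem_range.1 hn; omega)
    · exact dvd_zero 2
  · rw [hsplit, add_mul, ← hN]
    have : 0 ≤ (∑' n, f (n + (l + 1))) * 2 ^ (l + 1) := by positivity
    linarith
  · rw [hsplit, add_mul, ← hN]
    have := mul_le_mul_of_nonneg_right htail1 (show (0 : ℝ) ≤ 2 ^ (l + 1) by positivity)
    linarith

theorem not_immuneReal_leftmostPoint : ¬ ImmuneReal leftmostPoint := by
  rintro ⟨A, ⟨-, hA⟩, hx⟩
  have hlev : ∀ k, k < level k := fun k => by unfold level; nlinarith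
  -- The last digit of a truncation at `level k` has index `level k - 1`. Strict bounds in
  -- `exists_cell` force `N = m`, which is odd, so this index lies in `A`.
  refine hA {n | ∃ k < n + 1, level k = n + 1} ?_ ?_ ?_
  · rintro n ⟨k, -, hk⟩
    by_contra hn
    obtain ⟨N, h0, h1, h2⟩ := exists_nat_add_eq_realOfSet_mul A n
    obtain ⟨m, h3, h4, h5, -⟩ := exists_cell k
    rw [hx, ← hk] at h1 h2
    have h6 : m < N + 1 := by exact_mod_cast h4.trans_le h2
    have h7 : N < m + 1 := by exact_mod_cast h1.trans_lt h5
    have := h0 hn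
    omega
  · refine Set.infinite_of_forall_exists_gt fun a => ⟨level (a + 1) - 1, ⟨a + 1, ?_, ?_⟩, ?_⟩ <;>
      have := hlev (a + 1) <;> omega
  · have hp : PrimrecPred fun n : ℕ => ¬ ∀ k < n + 1, ¬ level k = n + 1 :=
      (PrimrecRel.bforall_lt (p := fun n k => ¬ level k = n + 1)
        (Primrec.eq.comp (primrec_level.comp Primrec.snd) (Primrec.succ.comp Primrec.fst)).not
        Primrec.succ).not
    obtain ⟨_, hp⟩ := hp
    have hc : ComputablePred fun n : ℕ => ¬ ∀ k < n + 1, ¬ level k = n + 1 := ⟨_, hp.to_comp⟩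
    refine hc.to_re.of_eq fun n => ?_
    simp

/-! ### Failure of superspeedability -/

theorem exists_stage {e : ℕ} (h : ∀ i, ∃ s, (guess e s i).isSome) (n : ℕ) :
    ∃ S, ∀ i < n, (guess e S i).isSome := by
  induction n with
  | zero => exact ⟨0, fun i hi => absurd hi (Nat.not_lt_zero i)⟩
  | succ n ih =>
    obtain ⟨S, hS⟩ := ih
    obtain ⟨s, hs⟩ := h n
    refine ⟨max S s, fun i hi => ?_⟩
    rcases Nat.lt_succ_iff_lt_or_eq.1 hi with hi | rfl
    · obtain ⟨v, hv⟩ := Option.isSome_iff_exists.1 (hS i hi)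
      rw [guess_mono (le_max_left S s) hv]; rfl
    · obtain ⟨v, hv⟩ := Option.isSome_iff_exists.1 hs
      rw [guess_mono (le_max_right S s) hv]; rfl

/-- The limit of the leftmost allowed cells lies in none of the forbidden intervals. -/
theorem ValidStep.overshoot_le {e S n : ℕ} (h : ValidStep e S n)
    (hlt : approx e S (n + 1) < leftmostPoint) :
    approx e S (n + 1) + lag e ^ 2 * (approx e S (n + 1) - approx e S n) ≤ leftmostPoint := by
  by_contra! hgt
  have hlev : Tendsto (fun s => leftEnd s + (1 / 2) ^ level s) atTop (𝓝 (leftmostPoint + 0)) :=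
    tendsto_leftEnd.add ((tendsto_pow_atTop_nhds_zero_of_lt_one (by norm_num) (by norm_num)).comp
      level_strictMono.tendsto_atTop)
  rw [add_zero] at hlev
  -- At a late stage the whole leftmost cell would lie inside the forbidden interval.
  obtain ⟨s, h1, h2, h3, h4, h5⟩ := ((tendsto_leftEnd.eventually_const_lt hlt).and
    ((hlev.eventually_lt_const hgt).and ((eventually_ge_atTop S).and
      ((eventually_gt_atTop e).and (eventually_gt_atTop n))))).exists
  refine (isLeast_leastCell s).1.2 e h4 n h5 ⟨h.mono h3, ?_⟩
  unfold Covers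
  rw [h.approx_eq h3 (by omega), h.approx_eq h3 (by omega), ← leftEnd_mul_level_self]
  have hpos : (0 : ℝ) < 2 ^ level s := by positivity
  refine ⟨mul_lt_mul_of_pos_right h1 hpos, ?_⟩
  have h6 := mul_lt_mul_of_pos_right h2 hpos
  rwa [add_mul, ← mul_pow, show (1 / 2 : ℝ) * 2 = 1 by norm_num, one_pow] at h6

/-- `ratOf` codes only nonnegative rationals, hence the shift by `n₀`, past which truncated
subtraction is exact. -/
theorem ComputableRatSeq.exists_code {a : ℕ → ℚ} (ha : ComputableRatSeq a) (n₀ : ℕ)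
    (hpos : ∀ n, n₀ ≤ n → 0 ≤ a n) : ∃ e, (∀ i, ∃ s, (guess e s i).isSome) ∧
      ∀ s i, (guess e s i).isSome → approx e s i = a (i + n₀) := by
  obtain ⟨p, q, r, hp, hq, hr, h⟩ := ha
  have hshift : Computable fun n => n + n₀ :=
    (Primrec.nat_add.comp Primrec.id (Primrec.const n₀)).to_comp
  set f : ℕ → ℕ := fun n => Nat.pair (p (n + n₀) - q (n + n₀)) (r (n + n₀)) with hf
  have hfc : Computable f := Primrec₂.natPair.to_comp.comp
    (Primrec.nat_sub.to_comp.comp (hp.comp hshift) (hq.comp hshift)) (hr.comp hshift)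
  obtain ⟨c, hc⟩ := Nat.Partrec.Code.exists_code.1 (Partrec.nat_iff.1 hfc)
  have hev : ∀ i, c.eval i = Part.some (f i) := fun i => by rw [hc]; rfl
  have hdec : Denumerable.ofNat Nat.Partrec.Code (Encodable.encode c) = c :=
    Denumerable.ofNat_encode c
  refine ⟨Encodable.encode c, fun i => ?_, fun s i hs => ?_⟩
  · obtain ⟨s, hs⟩ := Nat.Partrec.Code.evaln_complete.1
      (show f i ∈ c.eval i by rw [hev]; exact Part.mem_some _)
    exact ⟨s, by rw [guess, hdec, Option.mem_def.1 hs]; rfl⟩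
  · obtain ⟨v, hv⟩ := Option.isSome_iff_exists.1 hs
    have hv' := hv
    rw [guess, hdec] at hv'
    have hmem := Nat.Partrec.Code.evaln_sound (Option.mem_def.2 hv')
    rw [hev] at hmem
    obtain rfl := Part.mem_some_iff.1 hmem
    have h0 := hpos (i + n₀) (by omega)
    rw [h, le_div_iff₀ (by positivity), zero_mul, sub_nonneg] at h0
    rw [approx, guessVal, hv, h, Option.getD_some, ratOf, hf, Nat.unpair_pair]
    push_cast [Nat.cast_sub (show q (i + n₀) ≤ p (i + n₀) by exact_mod_cast h0)]
    rfl

theorem not_superspeedable_leftmostPoint : ¬ Superspeedable leftmostPoint := by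
  rintro ⟨a, ha, hlim⟩
  obtain ⟨n₀, hn₀⟩ := eventually_atTop.1 (ha.tendsto.eventually_const_lt leftmostPoint_pos)
  obtain ⟨e, hconv, hval⟩ := ha.computable.exists_code n₀ fun n hn => by
    exact_mod_cast (hn₀ n hn).le
  have hstep : Tendsto (fun n => ((a (n + 1 + n₀) : ℝ) - a (n + n₀)) * 2 ^ level e) atTop
      (𝓝 ((leftmostPoint - leftmostPoint) * 2 ^ level e)) := by
    refine Tendsto.mul_const _ (Tendsto.sub ?_ ?_)
    · exact (ha.tendsto.comp (tendsto_add_atTop_nat n₀)).comp (tendsto_add_atTop_nat 1)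
    · exact ha.tendsto.comp (tendsto_add_atTop_nat n₀)
  rw [sub_self, zero_mul] at hstep
  have hle : ∀ᶠ n in atTop, speedQuotient a leftmostPoint (n + n₀) ≤ 1 / (1 + lag e ^ 2) := by
    filter_upwards [hstep.eventually_le_const one_pos] with n hn
    obtain ⟨S, hS⟩ := exists_stage hconv (n + 2)
    have hv : ValidStep e S n := by
      refine ⟨hS, fun i hi => ?_, ?_⟩
      · rw [hval _ _ (hS i (by omega)), hval _ _ (hS (i + 1) (by omega))]
        exact_mod_cast ha.strictMono (by omega)
      · rwa [hval _ _ (hS n (by omega)), hval _ _ (hS (n + 1) (by omega))]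
    have h1 := hv.overshoot_le (by
      rw [hval _ _ (hS (n + 1) (by omega))]
      exact ha.lt _)
    rw [hval _ _ (hS n (by omega)), hval _ _ (hS (n + 1) (by omega)),
      show n + 1 + n₀ = n + n₀ + 1 by omega] at h1
    have h2 := ha.lt (n + n₀)
    unfold speedQuotient
    rw [div_le_div_iff₀ (by linarith) (by positivity)]
    linarith
  have hle' : ∀ᶠ n in atTop, speedQuotient a leftmostPoint n ≤ 1 / (1 + lag e ^ 2) := by
    rw [← map_add_atTop_eq_nat n₀]
    exact hle
  have hlimsup : limsup (speedQuotient a leftmostPoint) atTop ≤ 1 / (1 + lag e ^ 2) :=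
    limsup_le_of_le (isCoboundedUnder_le_of_le atTop fun n => (ha.speedQuotient_mem n).1.le) hle'
  have hlt : 1 / (1 + lag e ^ 2) < 1 := by
    rw [div_lt_one (by positivity)]
    have := pow_pos (lag_pos e) 2
    linarith
  linarith

/-! ### Speedability -/

open Classical in
/-- The coarsest level at which the truncations of `leftEnd s` and `leftEnd (s + 1)` differ. -/
noncomputable def firstJump (s : ℕ) : ℕ :=
  Nat.find (p := fun k => trunc s k < trunc (s + 1) k) ⟨s + 1, trunc_succ_lt s⟩

theorem isLeast_firstJump (s : ℕ) :
    IsLeast {k | trunc s k < trunc (s + 1) k} (firstJump s) := by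
  classical
  exact ⟨Nat.find_spec (p := fun k => trunc s k < trunc (s + 1) k) _,
    fun m hm => Nat.find_min' _ hm⟩

theorem firstJump_le (s : ℕ) : firstJump s ≤ s + 1 := (isLeast_firstJump s).2 (trunc_succ_lt s)

theorem computable_two_pow_level : Computable fun k => 2 ^ level k :=
  ((Primrec.const 2).nat_pow primrec_level).to_comp

theorem computable_trunc : Computable₂ trunc :=
  Primrec.nat_div.to_comp.comp (Primrec.nat_mul.to_comp.comp
    (computable_leastCell.comp Computable.fst) (computable_two_pow_level.comp Computable.snd))
    (computable_two_pow_level.comp Computable.fst)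

theorem computable_firstJump : Computable firstJump := by
  classical
  refine computable_of_isLeast (p := fun s k => trunc s k < trunc (s + 1) k) ?_ isLeast_firstJump
  exact (Primrec.nat_lt.decide.to_comp.comp computable_trunc
    (computable_trunc.comp (Computable.succ.comp Computable.fst) Computable.snd))

/-- Truncation of `leftEnd (s + 1)` just before the last digit of level `firstJump s`. -/
noncomputable def speedSeq (s : ℕ) : ℚ :=
  ((trunc (s + 1) (firstJump s) : ℕ) - (1 : ℕ)) / (((2 ^ level (firstJump s) - 1 : ℕ) : ℚ) + 1)

theorem computableRatSeq_speedSeq : ComputableRatSeq speedSeq :=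
  ⟨fun s => trunc (s + 1) (firstJump s), fun _ => 1, fun s => 2 ^ level (firstJump s) - 1,
    computable_trunc.comp Computable.succ computable_firstJump, Computable.const 1,
    Primrec.pred.to_comp.comp (computable_two_pow_level.comp computable_firstJump), fun _ => rfl⟩

theorem speedSeq_mul_pow (s : ℕ) :
    (speedSeq s : ℝ) * 2 ^ level (firstJump s) = trunc (s + 1) (firstJump s) - 1 := by
  have h : (((2 ^ level (firstJump s) - 1 : ℕ) : ℝ)) + 1 = 2 ^ level (firstJump s) := by
    rw [Nat.cast_sub Nat.one_le_two_pow]; push_cast; ring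
  unfold speedSeq
  push_cast
  rw [h]
  field_simp

theorem leftEnd_le_speedSeq (s : ℕ) : leftEnd s ≤ speedSeq s := by
  have hpos : (0 : ℝ) < 2 ^ level (firstJump s) := by positivity
  refine le_of_mul_le_mul_right ?_ hpos
  rw [speedSeq_mul_pow]
  have hlt : trunc s (firstJump s) < trunc (s + 1) (firstJump s) := (isLeast_firstJump s).1
  -- Up to level `s` both truncations are 1 mod 4, so they differ by more than one unit. At level `s
  -- + 1`, `leftEnd s` equals its truncation and a jump of one unit suffices.
  rcases Nat.lt_or_ge (firstJump s) (s + 1) with h | h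
  · have h1 := trunc_mod_four (s := s) (k := firstJump s) (by omega)
    have h2 := trunc_mod_four (s := s + 1) (k := firstJump s) (by omega)
    have h3 : trunc s (firstJump s) + 2 ≤ trunc (s + 1) (firstJump s) := by omega
    have h4 : (trunc s (firstJump s) : ℝ) + 2 ≤ trunc (s + 1) (firstJump s) := by
      exact_mod_cast h3
    have := lt_trunc_add_one s (firstJump s)
    linarith
  · have heq : firstJump s = s + 1 := le_antisymm (firstJump_le s) h
    rw [heq] at hlt ⊢
    rw [leftEnd_mul_level_succ]
    have : (trunc s (s + 1) : ℝ) + 1 ≤ trunc (s + 1) (s + 1) := by exact_mod_cast hlt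
    linarith

theorem speedSeq_lt_leftEnd_succ (s : ℕ) : (speedSeq s : ℝ) < leftEnd (s + 1) := by
  have hpos : (0 : ℝ) < 2 ^ level (firstJump s) := by positivity
  refine lt_of_mul_lt_mul_right ?_ hpos.le
  rw [speedSeq_mul_pow]
  have := trunc_le (s + 1) (firstJump s)
  linarith

theorem isLeftApproximation_speedSeq : IsLeftApproximation speedSeq leftmostPoint where
  computable := computableRatSeq_speedSeq
  strictMono := strictMono_nat_of_lt_succ fun s => by
    exact_mod_cast (speedSeq_lt_leftEnd_succ s).trans_le (leftEnd_le_speedSeq (s + 1))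
  tendsto := tendsto_of_tendsto_of_tendsto_of_le_of_le tendsto_leftEnd tendsto_const_nhds
    leftEnd_le_speedSeq
    fun s => ((speedSeq_lt_leftEnd_succ s).trans (leftEnd_lt_leftmostPoint (s + 1))).le

theorem half_le_speedQuotient {s m : ℕ} (hm : trunc (s + 1) (firstJump s) = m)
    (hx : leftmostPoint * 2 ^ level (firstJump s) < m + 1) :
    1 / 2 ≤ speedQuotient speedSeq leftmostPoint s := by
  have hpos : (0 : ℝ) < 2 ^ level (firstJump s) := by positivity
  have h1 := speedSeq_mul_pow s
  have h2 := trunc_le (s + 1) (firstJump s)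
  have h3 := mul_le_mul_of_nonneg_right (leftEnd_le_speedSeq (s + 1)) hpos.le
  rw [hm] at h1 h2
  have h4 := isLeftApproximation_speedSeq.lt s
  unfold speedQuotient
  rw [le_div_iff₀ (by linarith)]
  refine le_of_mul_le_mul_right ?_ hpos
  rw [mul_assoc, sub_mul, sub_mul]
  linarith

theorem frequently_half_le_speedQuotient :
    ∃ᶠ s in atTop, 1 / 2 ≤ speedQuotient speedSeq leftmostPoint s := by
  classical
  choose cell _ hlo hhi hev using exists_cell
  rw [frequently_atTop]
  intro N
  obtain ⟨k, hk⟩ : ∃ k, trunc N k ≠ cell k := by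
    by_contra! hall
    refine (leftEnd_lt_leftmostPoint N).not_ge (le_of_forall_pos_le_add fun ε hε => ?_)
    obtain ⟨k, hk⟩ := (((tendsto_pow_atTop_nhds_zero_of_lt_one (r := (1 / 2 : ℝ)) (by norm_num)
      (by norm_num)).comp level_strictMono.tendsto_atTop).eventually_lt_const hε).exists
    have hpos : (0 : ℝ) < 2 ^ level k := by positivity
    have h1 := hhi k
    rw [← hall k] at h1
    have h2 := trunc_le N k
    have h3 : leftmostPoint < leftEnd N + (1 / 2) ^ level k := by
      refine lt_of_mul_lt_mul_right ?_ hpos.le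
      rw [add_mul, ← mul_pow, show (1 / 2 : ℝ) * 2 = 1 by norm_num, one_pow]
      linarith
    have h4 : (1 / 2 : ℝ) ^ level k < ε := hk
    linarith
  -- At the first stage from `N` on where the truncation at `level k` is final, it has just jumped.
  -- The coarser truncation at `firstJump s` is determined by it, so it is final too.
  have hex : ∃ t, N ≤ t ∧ trunc t k = cell k :=
    ((eventually_ge_atTop N).and (hev k)).exists
  obtain ⟨hNt, htk⟩ := Nat.find_spec hex
  have hne : Nat.find hex ≠ N := fun h => hk (h ▸ htk)
  obtain ⟨s, hs⟩ := Nat.exists_eq_succ_of_ne_zero (show Nat.find hex ≠ 0 by omega)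
  have hmin : ¬ (N ≤ s ∧ trunc s k = cell k) := Nat.find_min hex (by omega)
  rw [hs] at hNt htk hne
  have hNs : N ≤ s := by omega
  have hlt : trunc s k < trunc (s + 1) k :=
    lt_of_le_of_ne (trunc_mono s.le_succ k) fun h => hmin ⟨hNs, h.trans htk⟩
  have hjk : firstJump s ≤ k := (isLeast_firstJump s).2 hlt
  refine ⟨s, hNs, half_le_speedQuotient ?_ (hhi (firstJump s))⟩
  obtain ⟨t, ht1, ht2⟩ := ((hev k).and (hev (firstJump s))).exists
  have hle : level (firstJump s) ≤ level k := level_strictMono.monotone hjk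
  rw [← ht2, trunc, mul_pow_div_pow_eq _ _ hle, trunc, mul_pow_div_pow_eq _ _ hle]
  exact congrArg (· / 2 ^ (level k - level (firstJump s))) (htk.trans ht1.symm)

theorem speedable_leftmostPoint : Speedable leftmostPoint := by
  refine ⟨speedSeq, isLeftApproximation_speedSeq, ?_⟩
  refine lt_of_lt_of_le (by norm_num : (0 : ℝ) < 1 / 2)
    (le_limsup_of_frequently_le frequently_half_le_speedQuotient ?_)
  exact isBoundedUnder_of ⟨1, fun n => (isLeftApproximation_speedSeq.speedQuotient_mem n).2.le⟩

theorem mainTheorem1 :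
    ∃ x : ℝ, x ∈ Set.Icc (0 : ℝ) 1 ∧ LeftComputable x ∧ ¬ ImmuneReal x ∧
      ¬ Superspeedable x ∧ Speedable x :=
  ⟨leftmostPoint, leftmostPoint_mem_Icc, ⟨speedSeq, isLeftApproximation_speedSeq⟩,
    not_immuneReal_leftmostPoint, not_superspeedable_leftmostPoint, speedable_leftmostPoint⟩
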